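/- For a finite field $\mathbb F_q$ with $q$ elements and $t\in\mathbb F_q^*$ let $S_t=\{x\in\mathbb F_q^2: x_1^2+x_2^2=t\}$, and write $S_t(\cdot)$ also for its indicator function. For $f:\mathbb F_q^2\to\mathbb R$ let $\|f\|_p=\big(q^{-2}\sum_{x\in\mathbb F_q^2}|f(x)|^p\big)^{1/p}$ if $1\le p<\infty$ and $\|f\|_\infty=\max_x|f(x)|$. For non-negative $f_1,\dots,f_4:\mathbb F_q^2\to\mathbb R$ put $$\diamondsuit_t(f_1,f_2,f_3,f_4)=\frac{1}{q^2|S_t|}\sum_{x^1,x^2,x^3,x^4\in\mathbb F_q^2}S_t(x^1-x^2)S_t(x^2-x^3)S_t(x^3-x^4)S_t(x^4-x^1)S_t(x^1-x^3)\prod_{i=1}^4f_i(x^i),$$ $$Y_t(f_1,f_2,f_3,f_4)=\frac{1}{q^2|S_t|^3}\sum_{x^1,x^2,x^3,x^4\in\mathbb F_q^2}S_t(x^3-x^1)S_t(x^3-x^2)S_t(x^3-x^4)\prod_{i=1}^4f_i(x^i).$$ **Theorem.** Let $1\le p_1,p_2,p_3,p_4\le\infty$. Consider any family of pairs $(\mathbb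 F_q,t)$, where $\mathbb F_q$ is a finite field of odd characteristic in which $3$ is a square and $t\in\mathbb F_q^*$ (for instance, the family of all such pairs). Suppose that there is a constant $C>0$ such that, for every pair $(\mathbb F_q,t)$ of the family, $$\diamondsuit_t(f_1,f_2,f_3,f_4)\le C\,\|f_1\|_{p_1}\|f_2\|_{p_2}\|f_3\|_{p_3}\|f_4\|_{p_4}\quad\text{for all non-negative } f_1,\dots,f_4:\mathbb F_q^2\to\mathbb R.$$ Then there is a constant $C'>0$ such that, for every pair $(\mathbb F_q,t)$ of the family, $$Y_t(f_1,f_2,f_3,f_4)\le C'\,\|f_1\|_{p_1}\|f_2\|_{p_2}\|f_3\|_{p_3}\|f_4\|_{p_4}\quad\text{for all non-negative } f_1,\dots,f_4:\mathbb F_q^2\to\mathbb R.$$ -/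

import Mathlib

open scoped ENNReal

noncomputable section

namespace FiniteFieldForms

/-- The circle `S_t = {x ∈ F² : x₁² + x₂² = t}`. -/
def circle {F : Type*} [Field F] (t : F) : Set (Fin 2 → F) :=
  {x | x 0 ^ 2 + x 1 ^ 2 = t}

/-- The indicator function of the circle `S_t`, with real values. -/
def circleInd {F : Type*} [Field F] (t : F) (x : Fin 2 → F) : ℝ :=
  (circle t).indicator (fun _ => 1) x

/-- The `L^p` norm, `1 ≤ p ≤ ∞`, for the normalized counting measure on a finite set `α`
(the plane `F²` below, so that `Fintype.card α = q²`). -/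
def normLp {α : Type*} [Fintype α] (p : ℝ≥0∞) (f : α → ℝ) : ℝ :=
  if p = ∞ then ⨆ x, |f x|
  else ((Fintype.card α : ℝ)⁻¹ * ∑ x, |f x| ^ p.toReal) ^ (1 / p.toReal)

/-- The form of the graph `C₄` + diagonal on `F²`: the four sides of the cycle
`x⁰ x¹ x² x³` and the diagonal `x⁰ x²` all have length `t`. In dimension two the normalizing
factor is `q² |S_t|`. -/
def diamondForm {F : Type*} [Field F] [Fintype F] (t : F)
    (f : Fin 4 → (Fin 2 → F) → ℝ) : ℝ :=
  1 / ((Fintype.card F : ℝ) ^ 2 * ((circle t).ncard : ℝ)) *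
    ∑ x : Fin 4 → (Fin 2 → F),
      circleInd t (x 0 - x 1) * circleInd t (x 1 - x 2) * circleInd t (x 2 - x 3) *
        circleInd t (x 3 - x 0) * circleInd t (x 0 - x 2) * ∏ l, f l (x l)

/-- The form of the `Y`-shaped graph on `F²`, with centre the third vertex `x²`;
the normalizing factor is `q² |S_t|³`. -/
def yForm {F : Type*} [Field F] [Fintype F] (t : F)
    (f : Fin 4 → (Fin 2 → F) → ℝ) : ℝ :=
  1 / ((Fintype.card F : ℝ) ^ 2 * ((circle t).ncard : ℝ) ^ 3) *
    ∑ x : Fin 4 → (Fin 2 → F),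
      circleInd t (x 2 - x 0) * circleInd t (x 2 - x 1) * circleInd t (x 2 - x 3) *
        ∏ l, f l (x l)

/-- For a family of finite fields `F i` and forms `Λ i` in four functions on `(F i)²`:
`Λ(p₁, p₂, p₃, p₄) ≲ 1`, that is, one constant `C`, the same for all members of the family,
bounds all the forms on non-negative functions. -/
def UniformlyBounded {ι : Type*} (F : ι → Type*) [∀ i, Fintype (F i)]
    (Λ : ∀ i, (Fin 4 → (Fin 2 → F i) → ℝ) → ℝ) (p : Fin 4 → ℝ≥0∞) : Prop :=
  ∃ C : ℝ, 0 < C ∧ ∀ (i : ι) (f : Fin 4 → (Fin 2 → F i) → ℝ), (∀ l x, 0 ≤ f l x) →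
    Λ i f ≤ C * ∏ l, normLp (p l) (f l)

end FiniteFieldForms

end

open scoped ENNReal

noncomputable section

namespace FiniteFieldForms

/-! Write `a l` for `1 / p l`, with value `0` at `p l = ∞`. Since `3` is a square, rotation by sixty
degrees is defined over the field, and every point `u` of the circle spans an equilateral triangle
with the origin. Placing these triangles in the diamond, with vertices 1 and 3 coinciding, and
testing on indicators of the origin and of the circle gives `q ^ (∑ l, e l * a l - 2) ≤ 16 * C` for
three weight vectors `e` (`rpow_card_le_of_diamondForm_le`). If some exponent is positive, `q` is
bounded on the family and a crude bound for `Y` suffices (`uniformlyBounded_yForm_of_rpow_card_le`).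
Otherwise three linear inequalities hold between the `a l`, and these imply the bound for `Y`.

The analytic input is that averaging over circles maps `L^{3/2}` to `L^3` uniformly
(`mean_cubeAvg_le`). It is purely combinatorial: two distinct circles of the same nonzero radius
share at most two points, and a circle has about `q` points. If all leaf exponents are at most `2 /
3`, Hölder's inequality at the centre finishes (`mean_star_le_of_small`). If one leaf exponent
exceeds `2 / 3`, self-adjointness moves its average onto the other factors
(`mean_star_le_of_large`). -/

/-- The mean of a real function on a finite type. -/
def mean {V : Type*} [Fintype V] (f : V → ℝ) : ℝ := (Fintype.card V : ℝ)⁻¹ * ∑ x, f x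

/-- The averages of a function over the finite sets `N x`, normalized by `m`. -/
def nbrAvg {V : Type*} (N : V → Finset V) (m : ℝ) (f : V → ℝ) (x : V) : ℝ :=
  m⁻¹ * ∑ y ∈ N x, f y

/-! ### Means and Hölder's inequality. -/

section Mean

variable {V : Type*} [Fintype V]

theorem mean_nonneg {f : V → ℝ} (hf : ∀ x, 0 ≤ f x) : 0 ≤ mean f :=
  mul_nonneg (by positivity) (Finset.sum_nonneg fun x _ => hf x)

theorem mean_mono {f g : V → ℝ} (h : ∀ x, f x ≤ g x) : mean f ≤ mean g :=
  mul_le_mul_of_nonneg_left (Finset.sum_le_sum fun x _ => h x) (by positivity)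

theorem mean_const_mul (c : ℝ) (f : V → ℝ) : mean (fun x => c * f x) = c * mean f := by
  simp only [mean, ← Finset.mul_sum]; ring

theorem mean_const [Nonempty V] (c : ℝ) : mean (fun _ : V => c) = c := by
  have : (Fintype.card V : ℝ) ≠ 0 := by simp
  simp [mean, this]

theorem eq_zero_of_mean_eq_zero [Nonempty V] {f : V → ℝ} (hf : ∀ x, 0 ≤ f x)
    (h : mean f = 0) (x : V) : f x = 0 := by
  have hc : (Fintype.card V : ℝ)⁻¹ ≠ 0 := by simp
  have := (mul_eq_zero.1 h).resolve_left hc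
  exact (Finset.sum_eq_zero_iff_of_nonneg fun x _ => hf x).1 this x (Finset.mem_univ x)

/-- Hölder's inequality for several functions and weights of sum at most one. -/
theorem mean_prod_rpow_le [Nonempty V] {ι : Type*} [Fintype ι] (w : ι → ℝ) (G : ι → V → ℝ)
    (hw : ∀ i, 0 ≤ w i) (hsum : ∑ i, w i ≤ 1) (hG : ∀ i x, 0 ≤ G i x) :
    mean (fun x => ∏ i, G i x ^ w i) ≤ ∏ i, mean (G i) ^ w i := by
  classical
  -- A function of mean zero vanishes, so the value 1 keeps both `mean (H i) = 1` and `G i = mean (G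
  -- i) * H i`.
  let H : ι → V → ℝ := fun i x => if mean (G i) = 0 then 1 else G i x / mean (G i)
  have hM : ∀ i, 0 ≤ mean (G i) := fun i => mean_nonneg (hG i)
  have hH : ∀ i x, 0 ≤ H i x := by
    intro i x
    simp only [H]
    split_ifs
    · exact zero_le_one
    · exact div_nonneg (hG i x) (hM i)
  have hHm : ∀ i, mean (H i) = 1 := by
    intro i
    by_cases h : mean (G i) = 0
    · simp only [H, h, if_true]; exact mean_const 1
    · have : H i = fun x => (mean (G i))⁻¹ * G i x := by
        ext x; simp only [H, h, if_false]; rw [div_eq_inv_mul]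
      rw [this, mean_const_mul, inv_mul_cancel₀ h]
  have hGH : ∀ i x, G i x = mean (G i) * H i x := by
    intro i x
    by_cases h : mean (G i) = 0
    · simp only [h, zero_mul]; exact eq_zero_of_mean_eq_zero (hG i) h x
    · simp only [H, h, if_false]; rw [mul_div_cancel₀ _ h]
  have hpt : ∀ x, ∏ i, H i x ^ w i ≤ (1 - ∑ i, w i) + ∑ i, w i * H i x := by
    intro x
    -- The missing weight `1 - ∑ i, w i` goes to an extra constant function 1, indexed by `none`.
    have := Real.geom_mean_le_arith_mean_weighted (Finset.univ : Finset (Option ι))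
      (fun o => o.elim (1 - ∑ i, w i) w) (fun o => o.elim 1 fun i => H i x)
      (by rintro (_ | i) _ <;> simp [hw, hsum]) (by simp)
      (by rintro (_ | i) _ <;> simp [hH])
    simpa using this
  have hmean : mean (fun x => (1 - ∑ i, w i) + ∑ i, w i * H i x) = 1 := by
    have h1 : mean (fun x => (1 - ∑ i, w i) + ∑ i, w i * H i x)
        = mean (fun _ : V => 1 - ∑ i, w i) + ∑ i, w i * mean (H i) := by
      simp only [mean, Finset.sum_add_distrib, mul_add]
      rw [Finset.sum_comm, Finset.mul_sum]
      simp only [Finset.mul_sum]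
      congr 1
      refine Finset.sum_congr rfl fun i _ => Finset.sum_congr rfl fun x _ => by ring
    rw [h1, mean_const]; simp [hHm]
  calc mean (fun x => ∏ i, G i x ^ w i)
      = mean (fun x => (∏ i, mean (G i) ^ w i) * ∏ i, H i x ^ w i) := by
        congr 1; ext x
        rw [← Finset.prod_mul_distrib]
        refine Finset.prod_congr rfl fun i _ => ?_
        rw [← Real.mul_rpow (hM i) (hH i x), ← hGH]
    _ = (∏ i, mean (G i) ^ w i) * mean (fun x => ∏ i, H i x ^ w i) := mean_const_mul _ _
    _ ≤ (∏ i, mean (G i) ^ w i) * 1 := by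
        refine mul_le_mul_of_nonneg_left ?_
          (Finset.prod_nonneg fun i _ => Real.rpow_nonneg (hM i) _)
        rw [← hmean]
        exact mean_mono hpt
    _ = _ := mul_one _

theorem rpow_le_card_mul_mean_rpow [Nonempty V] {F : V → ℝ} (hF : ∀ x, 0 ≤ F x) {a : ℝ}
    (ha0 : 0 ≤ a) (ha1 : a ≤ 1) (x : V) : F x ^ a ≤ Fintype.card V * mean F ^ a := by
  have hc : (1 : ℝ) ≤ Fintype.card V := by exact_mod_cast Fintype.card_pos
  have h1 : F x ≤ Fintype.card V * mean F := by
    rw [mean, mul_inv_cancel_left₀ (by positivity)]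
    exact Finset.single_le_sum (fun y _ => hF y) (Finset.mem_univ x)
  calc F x ^ a ≤ (Fintype.card V * mean F) ^ a := Real.rpow_le_rpow (hF x) h1 ha0
    _ = (Fintype.card V : ℝ) ^ a * mean F ^ a := Real.mul_rpow (by positivity) (mean_nonneg hF)
    _ ≤ (Fintype.card V : ℝ) ^ (1 : ℝ) * mean F ^ a := by
        have := Real.rpow_nonneg (mean_nonneg hF) a
        gcongr
    _ = _ := by rw [Real.rpow_one]

end Mean

/-! ### The averaging estimate from `L^{3/2}` to `L^3`. -/

/-- Hölder's inequality on all of `s` would put the factor `s.card` on the diagonal terms `g y ^ 6`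
too, which is too much. Splitting off a maximal value avoids this: the maximum pays for one diagonal
term, and the remaining diagonal terms are absorbed by products with the maximum. -/
theorem sum_sq_pow_three_le {V : Type*} [DecidableEq V] (s : Finset V) (g : V → ℝ)
    (hg : ∀ y, 0 ≤ g y) :
    (∑ y ∈ s, g y ^ 2) ^ 3 ≤
      4 * (∑ y ∈ s, g y ^ 6 + s.card * ∑ y ∈ s, ∑ z ∈ s.erase y, g y ^ 3 * g z ^ 3) := by
  rcases s.eq_empty_or_nonempty with rfl | hs
  · simp
  obtain ⟨y₀, hy₀, hmax⟩ := s.exists_max_image g hs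
  set r := s.erase y₀
  have hsplit : ∑ y ∈ s, g y ^ 2 = g y₀ ^ 2 + ∑ y ∈ r, g y ^ 2 :=
    (Finset.add_sum_erase s (fun y => g y ^ 2) hy₀).symm
  have hconv : ∀ a b : ℝ, 0 ≤ a → 0 ≤ b → (a + b) ^ 3 ≤ 4 * (a ^ 3 + b ^ 3) := by
    intro a b ha hb
    nlinarith [mul_nonneg (add_nonneg ha hb) (sq_nonneg (a - b))]
  have hholder : (∑ y ∈ r, g y ^ 2) ^ 3 ≤ s.card * (∑ y ∈ r, g y ^ 3) ^ 2 := by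
    have h := Finset.sum_sq_le_sum_mul_sum_of_sq_le_mul r (r := fun y => g y ^ 2)
      (f := g) (g := fun y => g y ^ 3) (fun y _ => hg y) (fun y _ => pow_nonneg (hg y) 3)
      (fun y _ => le_of_eq (by ring))
    have h' : (∑ y ∈ r, g y) ^ 2 ≤ r.card * ∑ y ∈ r, g y ^ 2 := sq_sum_le_card_mul_sum_sq
    have hcard : (r.card : ℝ) ≤ s.card := by
      exact_mod_cast Finset.card_le_card (Finset.erase_subset _ _)
    set a := ∑ y ∈ r, g y
    set b := ∑ y ∈ r, g y ^ 2
    set c := ∑ y ∈ r, g y ^ 3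
    have ha : 0 ≤ a := Finset.sum_nonneg fun y _ => hg y
    have hb : 0 ≤ b := Finset.sum_nonneg fun y _ => pow_nonneg (hg y) 2
    have hc : 0 ≤ c := Finset.sum_nonneg fun y _ => pow_nonneg (hg y) 3
    rcases hb.eq_or_lt with hb0 | hb0
    · rw [← hb0, zero_pow three_ne_zero]; positivity
    -- Combining `b ^ 2 ≤ a * c` with `a ^ 2 ≤ r.card * b` eliminates `a`; one factor `b` then
    -- cancels.
    have h2 : (b ^ 2) ^ 2 ≤ (a * c) ^ 2 := pow_le_pow_left₀ (by positivity) h 2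
    have h3 : b * b ^ 3 ≤ b * (s.card * c ^ 2) := by
      calc b * b ^ 3 = (b ^ 2) ^ 2 := by ring
        _ ≤ a ^ 2 * c ^ 2 := by rw [← mul_pow]; exact h2
        _ ≤ (s.card * b) * c ^ 2 := by
          gcongr
          exact h'.trans (by gcongr)
        _ = _ := by ring
    exact le_of_mul_le_mul_left h3 hb0
  have hP : (∑ y ∈ r, g y ^ 3) ^ 2 ≤ ∑ y ∈ s, ∑ z ∈ s.erase y, g y ^ 3 * g z ^ 3 := by
    have hone : ∑ z ∈ s.erase y₀, g y₀ ^ 3 * g z ^ 3 = ∑ y ∈ r, g y₀ ^ 3 * g y ^ 3 := rfl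
    rw [← Finset.add_sum_erase s _ hy₀, hone, ← Finset.sum_add_distrib, sq, Finset.sum_mul]
    refine Finset.sum_le_sum fun y hy => ?_
    have hys : y ∈ s := Finset.mem_of_mem_erase hy
    -- The diagonal term `g y ^ 3 * g y ^ 3` is charged to the pair `(y₀, y)`, the others to
    -- themselves.
    rw [Finset.mul_sum, ← Finset.add_sum_erase r _ hy]
    gcongr
    · exact pow_nonneg (hg y) 3
    · exact hg y
    · exact hmax y hys
    · intro i _ _; exact mul_nonneg (pow_nonneg (hg _) 3) (pow_nonneg (hg _) 3)
    · exact Finset.erase_subset _ _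
  calc (∑ y ∈ s, g y ^ 2) ^ 3 ≤ 4 * ((g y₀ ^ 2) ^ 3 + (∑ y ∈ r, g y ^ 2) ^ 3) := by
        rw [hsplit]
        exact hconv _ _ (by positivity) (Finset.sum_nonneg fun y _ => pow_nonneg (hg y) 2)
    _ ≤ _ := by
        gcongr
        · rw [← pow_mul]
          exact Finset.single_le_sum (f := fun y => g y ^ 6) (fun y _ => pow_nonneg (hg y) 6) hy₀
        · exact hholder.trans (by gcongr)

section Neighbours

variable {V : Type*} {N : V → Finset V} {m : ℕ}

theorem nbrAvg_nonneg {f : V → ℝ} (hf : ∀ x, 0 ≤ f x) (x : V) : 0 ≤ nbrAvg N m f x :=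
  mul_nonneg (by positivity) (Finset.sum_nonneg fun y _ => hf y)

theorem nbrAvg_mono {f g : V → ℝ} (h : ∀ x, f x ≤ g x) (x : V) :
    nbrAvg N m f x ≤ nbrAvg N m g x :=
  mul_le_mul_of_nonneg_left (Finset.sum_le_sum fun y _ => h y) (by positivity)

theorem nbrAvg_rpow_le (hm : 0 < m) (hcard : ∀ x, (N x).card = m) {a : ℝ} (ha0 : 0 ≤ a)
    (ha1 : a ≤ 1) {F : V → ℝ} (hF : ∀ x, 0 ≤ F x) (x : V) :
    nbrAvg N m (fun y => F y ^ a) x ≤ nbrAvg N m F x ^ a := by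
  have hm' : (m : ℝ) ≠ 0 := by positivity
  rcases ha0.eq_or_lt with rfl | ha
  · simp [nbrAvg, hcard, hm']
  have := Real.arith_mean_le_rpow_mean (N x) (fun _ => (m : ℝ)⁻¹) (fun y => F y ^ a)
    (fun _ _ => by positivity) (by simp [hcard, hm']) (fun y _ => Real.rpow_nonneg (hF y) _)
    (p := 1 / a) (by rw [le_div_iff₀ ha]; linarith)
  have h2 : ∀ y, (F y ^ a) ^ (1 / a) = F y := fun y => by
    rw [← Real.rpow_mul (hF y), mul_one_div_cancel ha.ne', Real.rpow_one]
  simp only [h2, one_div_one_div, ← Finset.mul_sum] at this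
  exact this

/-- The cube of the average of `F ^ (2 / 3)`; its powers of exponent `a / 2` dominate the averages of
`F ^ a` for `a ≤ 2 / 3`. -/
def cubeAvg (N : V → Finset V) (m : ℕ) (F : V → ℝ) (x : V) : ℝ :=
  nbrAvg N m (fun y => F y ^ (2 / 3 : ℝ)) x ^ 3

theorem cubeAvg_nonneg {F : V → ℝ} (hF : ∀ x, 0 ≤ F x) (x : V) : 0 ≤ cubeAvg N m F x :=
  pow_nonneg (nbrAvg_nonneg (fun y => Real.rpow_nonneg (hF y) _) x) 3

/-- Power means increase with the exponent: `a ≤ 2 / 3` makes `3 * a / 2 ≤ 1`, so Jensen's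
inequality applies to `F ^ (2 / 3)`. -/
theorem nbrAvg_rpow_le_cubeAvg (hm : 0 < m) (hcard : ∀ x, (N x).card = m) {a : ℝ} (ha0 : 0 ≤ a)
    (ha1 : a ≤ 2 / 3) {F : V → ℝ} (hF : ∀ x, 0 ≤ F x) (x : V) :
    nbrAvg N m (fun y => F y ^ a) x ≤ cubeAvg N m F x ^ (a / 2) := by
  have h := nbrAvg_rpow_le hm hcard (a := 3 * a / 2) (by linarith) (by linarith)
    (F := fun y => F y ^ (2 / 3 : ℝ)) (fun y => Real.rpow_nonneg (hF y) _) x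
  have h1 : ∀ y, (F y ^ (2 / 3 : ℝ)) ^ (3 * a / 2) = F y ^ a := fun y => by
    rw [← Real.rpow_mul (hF y)]; congr 1; ring
  simp only [h1] at h
  refine h.trans_eq ?_
  rw [cubeAvg, ← Real.rpow_natCast, ← Real.rpow_mul
    (nbrAvg_nonneg (fun y => Real.rpow_nonneg (hF y) _) x)]
  congr 1; push_cast; ring

variable [Fintype V]

theorem sum_sum_nbr_comm (hsymm : ∀ x y, y ∈ N x ↔ x ∈ N y) (f : V → V → ℝ) :
    ∑ x, ∑ y ∈ N x, f x y = ∑ y, ∑ x ∈ N y, f x y :=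
  Finset.sum_comm' (by simp [hsymm])

/-- Averaging over the neighbours is self-adjoint. -/
theorem mean_mul_nbrAvg (hsymm : ∀ x y, y ∈ N x ↔ x ∈ N y) (f g : V → ℝ) :
    mean (fun x => f x * nbrAvg N m g x) = mean (fun x => g x * nbrAvg N m f x) := by
  have : ∀ f g : V → ℝ, ∑ x, f x * nbrAvg N m g x = (m : ℝ)⁻¹ * ∑ x, ∑ y ∈ N x, f x * g y := by
    intro f g
    simp only [nbrAvg, Finset.mul_sum]
    refine Finset.sum_congr rfl fun x _ => Finset.sum_congr rfl fun y _ => by ring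
  simp only [mean]
  rw [this, this, sum_sum_nbr_comm hsymm]
  simp only [mul_comm]

/-- The trivial bound for the `Y` form, with a constant depending on the size of the space. -/
theorem mean_star_le_card [Nonempty V] (hm : 0 < m) (hcard : ∀ x, (N x).card = m)
    {E F G H : V → ℝ} (hE : ∀ x, 0 ≤ E x)
    (hF : ∀ x, 0 ≤ F x) (hG : ∀ x, 0 ≤ G x) (hH : ∀ x, 0 ≤ H x) {c a b d : ℝ}
    (hc0 : 0 ≤ c) (ha0 : 0 ≤ a) (hb0 : 0 ≤ b) (hd0 : 0 ≤ d) (hc : c ≤ 1) (ha : a ≤ 1)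
    (hb : b ≤ 1) (hd : d ≤ 1) :
    mean (fun x => E x ^ c * nbrAvg N m (fun y => F y ^ a) x * nbrAvg N m (fun y => G y ^ b) x *
      nbrAvg N m (fun y => H y ^ d) x) ≤
      (Fintype.card V : ℝ) ^ 4 * (mean E ^ c * mean F ^ a * mean G ^ b * mean H ^ d) := by
  have hm' : (m : ℝ) ≠ 0 := by positivity
  have q : ∀ {F : V → ℝ}, (∀ x, 0 ≤ F x) → ∀ {a : ℝ}, 0 ≤ a → a ≤ 1 → ∀ x,
      nbrAvg N m (fun y => F y ^ a) x ≤ Fintype.card V * mean F ^ a := by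
    intro F hF a ha0 ha x
    refine (nbrAvg_mono (rpow_le_card_mul_mean_rpow hF ha0 ha) x).trans_eq ?_
    simp [nbrAvg, hcard, hm']
  have r : ∀ {F : V → ℝ}, (∀ x, 0 ≤ F x) → ∀ a : ℝ, 0 ≤ Fintype.card V * mean F ^ a :=
    fun hF a => mul_nonneg (by positivity) (Real.rpow_nonneg (mean_nonneg hF) a)
  have n : ∀ {F : V → ℝ}, (∀ x, 0 ≤ F x) → ∀ (a : ℝ) x, 0 ≤ nbrAvg N m (fun y => F y ^ a) x :=
    fun hF a x => nbrAvg_nonneg (fun y => Real.rpow_nonneg (hF y) a) x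
  refine (mean_mono (g := fun _ => (Fintype.card V * mean E ^ c) * (Fintype.card V * mean F ^ a) *
    (Fintype.card V * mean G ^ b) * (Fintype.card V * mean H ^ d)) fun x => ?_).trans_eq ?_
  · exact mul_le_mul (mul_le_mul (mul_le_mul (rpow_le_card_mul_mean_rpow hE hc0 hc x)
      (q hF ha0 ha x) (n hF a x) (r hE c)) (q hG hb0 hb x) (n hG b x)
      (mul_nonneg (r hE c) (r hF a))) (q hH hd0 hd x) (n hH d x)
      (mul_nonneg (mul_nonneg (r hE c) (r hF a)) (r hG b))
  · rw [mean_const]; ring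

variable [DecidableEq V]

/-- Double counting after `sum_sq_pow_three_le` with `g = F ^ (1 / 3)`: a point `y` lies in `m`
neighbourhoods, a pair `y ≠ z` in at most two. Hence `12 = 4 * (1 + 2)`. -/
theorem sum_nbr_pow_three_le (hsymm : ∀ x y, y ∈ N x ↔ x ∈ N y) (hcard : ∀ x, (N x).card = m)
    (hcommon : ∀ y z, y ≠ z → (N y ∩ N z).card ≤ 2) (F : V → ℝ) (hF : ∀ x, 0 ≤ F x) :
    ∑ x, (∑ y ∈ N x, F y ^ (2 / 3 : ℝ)) ^ 3 ≤ 12 * m * (∑ x, F x) ^ 2 := by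
  set g : V → ℝ := fun y => F y ^ (1 / 3 : ℝ)
  have hg : ∀ y, 0 ≤ g y := fun y => Real.rpow_nonneg (hF y) _
  have hg2 : ∀ y, F y ^ (2 / 3 : ℝ) = g y ^ 2 := fun y => by
    simp only [g]; rw [← Real.rpow_natCast, ← Real.rpow_mul (hF y)]; norm_num
  have hg3 : ∀ y, g y ^ 3 = F y := fun y => by
    simp only [g]; rw [← Real.rpow_natCast, ← Real.rpow_mul (hF y)]; norm_num
  have hg6 : ∀ y, g y ^ 6 = F y ^ 2 := fun y => by rw [← hg3 y]; ring
  have hsq : ∑ y, F y ^ 2 ≤ (∑ y, F y) ^ 2 :=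
    Finset.sum_sq_le_sq_sum_of_nonneg fun y _ => hF y
  have hdiag : ∑ x, ∑ y ∈ N x, F y ^ 2 ≤ m * (∑ y, F y) ^ 2 := by
    rw [sum_sum_nbr_comm hsymm]
    simp only [Finset.sum_const, hcard, nsmul_eq_mul, ← Finset.mul_sum]
    gcongr
  have hoff : ∑ x, ∑ y ∈ N x, ∑ z ∈ (N x).erase y, F y * F z ≤ 2 * (∑ y, F y) ^ 2 := by
    rw [sum_sum_nbr_comm hsymm]
    have h1 : ∀ y, ∑ x ∈ N y, ∑ z ∈ (N x).erase y, F y * F z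
        = ∑ z ∈ Finset.univ.erase y, ∑ x ∈ N y ∩ N z, F y * F z := by
      intro y
      refine Finset.sum_comm' ?_
      intro x z
      simp only [Finset.mem_erase, Finset.mem_univ, and_true, Finset.mem_inter, hsymm x z]
      tauto
    have h2 : ∀ y, ∑ z ∈ Finset.univ.erase y, ∑ x ∈ N y ∩ N z, F y * F z
        ≤ ∑ z, 2 * (F y * F z) := by
      intro y
      refine (Finset.sum_le_sum fun z hz => ?_).trans
        (Finset.sum_le_sum_of_subset_of_nonneg (Finset.erase_subset _ _) fun z _ _ =>
          mul_nonneg zero_le_two (mul_nonneg (hF y) (hF z)))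
      rw [Finset.sum_const, nsmul_eq_mul]
      refine mul_le_mul_of_nonneg_right ?_ (mul_nonneg (hF y) (hF z))
      exact_mod_cast hcommon y z (Finset.ne_of_mem_erase hz).symm
    calc _ ≤ ∑ y, ∑ z, 2 * (F y * F z) := Finset.sum_le_sum fun y _ => by rw [h1]; exact h2 y
      _ = 2 * (∑ y, F y) ^ 2 := by
        simp only [← Finset.mul_sum, sq, Finset.sum_mul]
  calc ∑ x, (∑ y ∈ N x, F y ^ (2 / 3 : ℝ)) ^ 3
      ≤ ∑ x, 4 * (∑ y ∈ N x, F y ^ 2 + m * ∑ y ∈ N x, ∑ z ∈ (N x).erase y, F y * F z) := by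
        refine Finset.sum_le_sum fun x _ => ?_
        have := sum_sq_pow_three_le (N x) g hg
        simpa only [hg2, hg3, hg6, hcard] using this
    _ = 4 * (∑ x, ∑ y ∈ N x, F y ^ 2
          + m * ∑ x, ∑ y ∈ N x, ∑ z ∈ (N x).erase y, F y * F z) := by
        rw [← Finset.mul_sum, Finset.sum_add_distrib, ← Finset.mul_sum]
    _ ≤ 4 * (m * (∑ y, F y) ^ 2 + m * (2 * (∑ y, F y) ^ 2)) := by gcongr
    _ = _ := by ring

/-- The averaging operator maps `L^{3/2}` to `L^3`, with a uniform constant. -/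
theorem mean_cubeAvg_le [Nonempty V] (hm : 0 < m) (hsymm : ∀ x y, y ∈ N x ↔ x ∈ N y)
    (hcard : ∀ x, (N x).card = m) (hcommon : ∀ y z, y ≠ z → (N y ∩ N z).card ≤ 2)
    (hV : (Fintype.card V : ℝ) ≤ 4 * (m : ℝ) ^ 2) {F : V → ℝ} (hF : ∀ x, 0 ≤ F x) :
    mean (cubeAvg N m F) ≤ 48 * mean F ^ 2 := by
  have h := sum_nbr_pow_three_le hsymm hcard hcommon F hF
  have hm' : (0 : ℝ) < m := by exact_mod_cast hm
  have hc : (0 : ℝ) < Fintype.card V := by exact_mod_cast Fintype.card_pos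
  simp only [mean, cubeAvg, nbrAvg, mul_pow, ← Finset.mul_sum]
  calc (Fintype.card V : ℝ)⁻¹ * ((m : ℝ)⁻¹ ^ 3 * ∑ x, (∑ y ∈ N x, F y ^ (2 / 3 : ℝ)) ^ 3)
      ≤ (Fintype.card V : ℝ)⁻¹ * ((m : ℝ)⁻¹ ^ 3 * (12 * m * (∑ x, F x) ^ 2)) := by gcongr
    -- Normalization leaves the ratio `card V / m ^ 2`, which `hV` bounds by 4.
    _ = 12 * (Fintype.card V / (m : ℝ) ^ 2) * ((Fintype.card V : ℝ)⁻¹ ^ 2 * (∑ x, F x) ^ 2) := by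
        field_simp
    _ ≤ 12 * 4 * ((Fintype.card V : ℝ)⁻¹ ^ 2 * (∑ x, F x) ^ 2) := by
        gcongr
        rw [div_le_iff₀ (by positivity)]; exact hV
    _ = _ := by ring

theorem mean_cubeAvg_rpow_le [Nonempty V] (hm : 0 < m) (hsymm : ∀ x y, y ∈ N x ↔ x ∈ N y)
    (hcard : ∀ x, (N x).card = m) (hcommon : ∀ y z, y ≠ z → (N y ∩ N z).card ≤ 2)
    (hV : (Fintype.card V : ℝ) ≤ 4 * (m : ℝ) ^ 2) {F : V → ℝ} (hF : ∀ x, 0 ≤ F x)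
    {a : ℝ} (ha0 : 0 ≤ a) (ha1 : a ≤ 2) :
    mean (cubeAvg N m F) ^ (a / 2) ≤ 48 * mean F ^ a := by
  have hM := mean_nonneg hF
  calc mean (cubeAvg N m F) ^ (a / 2) ≤ (48 * mean F ^ 2) ^ (a / 2) :=
        Real.rpow_le_rpow (mean_nonneg (cubeAvg_nonneg hF))
          (mean_cubeAvg_le hm hsymm hcard hcommon hV hF) (by linarith)
    _ = 48 ^ (a / 2) * mean F ^ a := by
        rw [Real.mul_rpow (by norm_num) (by positivity), ← Real.rpow_natCast, ← Real.rpow_mul hM]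
        congr 2; push_cast; ring
    _ ≤ 48 ^ (1 : ℝ) * mean F ^ a := by
        gcongr
        · norm_num
        · linarith
    _ = _ := by rw [Real.rpow_one]

/-! ### Hölder bounds for the star. -/

/-- The `Y` form, when all leaf exponents are at most `2 / 3`. -/
theorem mean_star_le_of_small [Nonempty V] (hm : 0 < m) (hsymm : ∀ x y, y ∈ N x ↔ x ∈ N y)
    (hcard : ∀ x, (N x).card = m) (hcommon : ∀ y z, y ≠ z → (N y ∩ N z).card ≤ 2)
    (hV : (Fintype.card V : ℝ) ≤ 4 * (m : ℝ) ^ 2) {E F G H : V → ℝ} (hE : ∀ x, 0 ≤ E x)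
    (hF : ∀ x, 0 ≤ F x) (hG : ∀ x, 0 ≤ G x) (hH : ∀ x, 0 ≤ H x) {c a b d : ℝ}
    (hc0 : 0 ≤ c) (ha0 : 0 ≤ a) (hb0 : 0 ≤ b) (hd0 : 0 ≤ d) (ha : a ≤ 2 / 3) (hb : b ≤ 2 / 3)
    (hd : d ≤ 2 / 3) (hsum : c + a / 2 + b / 2 + d / 2 ≤ 1) :
    mean (fun x => E x ^ c * nbrAvg N m (fun y => F y ^ a) x * nbrAvg N m (fun y => G y ^ b) x *
      nbrAvg N m (fun y => H y ^ d) x) ≤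
      48 ^ 3 * (mean E ^ c * mean F ^ a * mean G ^ b * mean H ^ d) := by
  have hold := mean_prod_rpow_le ![c, a / 2, b / 2, d / 2]
    ![E, cubeAvg N m F, cubeAvg N m G, cubeAvg N m H]
    (by intro i; fin_cases i <;> simp <;> linarith)
    (by simp [Fin.sum_univ_four]; linarith)
    (by
      intro i x
      fin_cases i
      · exact hE x
      · exact cubeAvg_nonneg hF x
      · exact cubeAvg_nonneg hG x
      · exact cubeAvg_nonneg hH x)
  simp only [Fin.prod_univ_four] at hold
  have key : ∀ {F : V → ℝ}, (∀ x, 0 ≤ F x) → ∀ {a : ℝ}, 0 ≤ a → a ≤ 2 / 3 →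
      mean (cubeAvg N m F) ^ (a / 2) ≤ 48 * mean F ^ a := fun hF _ ha0 ha =>
    mean_cubeAvg_rpow_le hm hsymm hcard hcommon hV hF ha0 (by linarith)
  have hnn : ∀ {F : V → ℝ}, (∀ x, 0 ≤ F x) → ∀ a : ℝ, 0 ≤ mean F ^ a := fun hF a =>
    Real.rpow_nonneg (mean_nonneg hF) a
  calc _ ≤ _ := mean_mono fun x => ?_
    _ ≤ _ := hold
    _ ≤ mean E ^ c * (48 * mean F ^ a) * (48 * mean G ^ b) * (48 * mean H ^ d) := by
      have h1 := hnn hE c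
      have h2 := hnn hF a
      have h3 := hnn hG b
      have h4 := hnn (cubeAvg_nonneg (N := N) (m := m) hG) (b / 2)
      have h5 := hnn (cubeAvg_nonneg (N := N) (m := m) hH) (d / 2)
      have h6 := hnn (cubeAvg_nonneg (N := N) (m := m) hF) (a / 2)
      exact mul_le_mul (mul_le_mul (mul_le_mul le_rfl (key hF ha0 ha) h6 h1) (key hG hb0 hb) h4
        (by positivity)) (key hH hd0 hd) h5 (by positivity)
    _ = _ := by ring
  have q : ∀ {F : V → ℝ}, (∀ x, 0 ≤ F x) → ∀ a : ℝ, 0 ≤ nbrAvg N m (fun y => F y ^ a) x :=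
    fun hF a => nbrAvg_nonneg (fun y => Real.rpow_nonneg (hF y) a) x
  have r : ∀ {F : V → ℝ}, (∀ x, 0 ≤ F x) → ∀ a : ℝ, 0 ≤ cubeAvg N m F x ^ a :=
    fun hF a => Real.rpow_nonneg (cubeAvg_nonneg hF x) a
  have h1 := Real.rpow_nonneg (hE x) c
  have h2 := q hF a
  have h3 := q hG b
  have h4 := q hH d
  have h5 := r hF (a / 2)
  have h6 := r hG (b / 2)
  exact mul_le_mul (mul_le_mul (mul_le_mul le_rfl
    (nbrAvg_rpow_le_cubeAvg hm hcard ha0 ha hF x) h2 h1)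
    (nbrAvg_rpow_le_cubeAvg hm hcard hb0 hb hG x) h3 (mul_nonneg h1 h5))
    (nbrAvg_rpow_le_cubeAvg hm hcard hd0 hd hH x) h4 (mul_nonneg (mul_nonneg h1 h5) h6)

/-- The `Y` form, when one leaf exponent is large and dominates the other exponents. -/
theorem mean_star_le_of_large [Nonempty V] (hm : 0 < m) (hsymm : ∀ x y, y ∈ N x ↔ x ∈ N y)
    (hcard : ∀ x, (N x).card = m) (hcommon : ∀ y z, y ≠ z → (N y ∩ N z).card ≤ 2)
    (hV : (Fintype.card V : ℝ) ≤ 4 * (m : ℝ) ^ 2) {E F G H : V → ℝ} (hE : ∀ x, 0 ≤ E x)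
    (hF : ∀ x, 0 ≤ F x) (hG : ∀ x, 0 ≤ G x) (hH : ∀ x, 0 ≤ H x) {c a b d : ℝ}
    (hc0 : 0 ≤ c) (hb0 : 0 ≤ b) (hd0 : 0 ≤ d) (ha : 2 / 3 ≤ a) (hb : b ≤ 2 / 3)
    (hd : d ≤ 2 / 3) (hsum : c + b / 2 + d / 2 ≤ 2 - 2 * a) :
    mean (fun x => E x ^ c * nbrAvg N m (fun y => F y ^ a) x * nbrAvg N m (fun y => G y ^ b) x *
      nbrAvg N m (fun y => H y ^ d) x) ≤
      48 ^ 3 * (mean E ^ c * mean F ^ a * mean G ^ b * mean H ^ d) := by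
  set s := 2 - 2 * a with hs
  have hs0 : 0 ≤ s := by linarith
  have ha1 : a ≤ 1 := by linarith
  have hME := mean_nonneg hE
  have hMF := mean_nonneg hF
  have hMG := mean_nonneg hG
  have hMH := mean_nonneg hH
  have hG' := cubeAvg_nonneg (N := N) (m := m) hG
  have hH' := cubeAvg_nonneg (N := N) (m := m) hH
  have hMG' := mean_nonneg hG'
  have hMH' := mean_nonneg hH'
  -- `K` is chosen so that `K ^ s` dominates everything but the large leaf; after division by `s`
  -- its exponents sum to at most 1, so Hölder's inequality controls `mean K`.
  set K : V → ℝ := fun x => E x ^ (c / s) * cubeAvg N m G x ^ (b / 2 / s) *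
    cubeAvg N m H x ^ (d / 2 / s) with hK
  have hK0 : ∀ x, 0 ≤ K x := fun x =>
    mul_nonneg (mul_nonneg (Real.rpow_nonneg (hE x) _) (Real.rpow_nonneg (hG' x) _))
      (Real.rpow_nonneg (hH' x) _)
  have hdiv : ∀ {u : ℝ}, 0 ≤ u → u ≤ s → u / s * s = u := by
    intro u hu hus
    -- When `s = 0` the numerator also vanishes, so division by zero does no harm.
    rcases eq_or_ne s 0 with h | h
    · rw [h]; simp; linarith
    · exact div_mul_cancel₀ u h
  have hpow : ∀ {u v w : ℝ}, 0 ≤ u → 0 ≤ v → 0 ≤ w →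
      (u ^ (c / s) * v ^ (b / 2 / s) * w ^ (d / 2 / s)) ^ s
        = u ^ c * v ^ (b / 2) * w ^ (d / 2) := by
    intro u v w hu hv hw
    rw [Real.mul_rpow (by positivity) (by positivity), Real.mul_rpow (by positivity)
      (by positivity), ← Real.rpow_mul hu, ← Real.rpow_mul hv, ← Real.rpow_mul hw,
      hdiv hc0 (by linarith), hdiv (by linarith) (by linarith), hdiv (by linarith) (by linarith)]
  have hMK : mean K ≤ mean E ^ (c / s) * mean (cubeAvg N m G) ^ (b / 2 / s) *
      mean (cubeAvg N m H) ^ (d / 2 / s) := by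
    have hold := mean_prod_rpow_le ![c / s, b / 2 / s, d / 2 / s]
      ![E, cubeAvg N m G, cubeAvg N m H]
      (by intro i; fin_cases i <;> simp <;> positivity)
      (by
        simp only [Fin.sum_univ_three]
        change c / s + b / 2 / s + d / 2 / s ≤ 1
        rw [← add_div, ← add_div]
        exact div_le_one_of_le₀ hsum hs0)
      (by
        intro i x
        fin_cases i
        · exact hE x
        · exact hG' x
        · exact hH' x)
    simp only [Fin.prod_univ_three] at hold
    exact hold
  have hMKs : mean K ^ s ≤ mean E ^ c * (48 * mean G ^ b) * (48 * mean H ^ d) := by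
    refine (Real.rpow_le_rpow (mean_nonneg hK0) hMK hs0).trans ?_
    rw [hpow hME hMG' hMH']
    gcongr
    · exact mean_cubeAvg_rpow_le hm hsymm hcard hcommon hV hG hb0 (by linarith)
    · exact mean_cubeAvg_rpow_le hm hsymm hcard hcommon hV hH hd0 (by linarith)
  have hpt : ∀ x, E x ^ c * nbrAvg N m (fun y => G y ^ b) x * nbrAvg N m (fun y => H y ^ d) x
      ≤ K x ^ s := by
    intro x
    simp only [hK]
    rw [hpow (hE x) (hG' x) (hH' x)]
    have h1 := Real.rpow_nonneg (hE x) c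
    have h2 := Real.rpow_nonneg (hG' x) (b / 2)
    exact mul_le_mul (mul_le_mul le_rfl (nbrAvg_rpow_le_cubeAvg hm hcard hb0 hb hG x)
      (nbrAvg_nonneg (fun y => Real.rpow_nonneg (hG y) _) x) h1)
      (nbrAvg_rpow_le_cubeAvg hm hcard hd0 hd hH x)
      (nbrAvg_nonneg (fun y => Real.rpow_nonneg (hH y) _) x) (mul_nonneg h1 h2)
  have hKK := cubeAvg_nonneg (N := N) (m := m) hK0
  -- By the choice of `s` these weights sum to exactly 1.
  have hold := mean_prod_rpow_le ![a, s / 2] ![F, cubeAvg N m K]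
    (by intro i; fin_cases i <;> simp <;> linarith)
    (by simp [Fin.sum_univ_two]; linarith)
    (by
      intro i x
      fin_cases i
      · exact hF x
      · exact hKK x)
  simp only [Fin.prod_univ_two] at hold
  calc _ = mean (fun x => (E x ^ c * nbrAvg N m (fun y => G y ^ b) x *
          nbrAvg N m (fun y => H y ^ d) x) * nbrAvg N m (fun y => F y ^ a) x) := by
        congr 1; ext x; ring
    -- The average of `F ^ a` is not dominated through `cubeAvg` when `a > 2 / 3`; the average of `K
    -- ^ s` is, because `s ≤ 2 / 3`.
    _ = mean (fun x => F x ^ a * nbrAvg N m (fun x => E x ^ c * nbrAvg N m (fun y => G y ^ b) x *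
          nbrAvg N m (fun y => H y ^ d) x) x) := mean_mul_nbrAvg hsymm _ _
    _ ≤ mean (fun x => F x ^ a * cubeAvg N m K x ^ (s / 2)) := mean_mono fun x =>
        mul_le_mul_of_nonneg_left ((nbrAvg_mono hpt x).trans
          (nbrAvg_rpow_le_cubeAvg hm hcard hs0 (by linarith) hK0 x)) (Real.rpow_nonneg (hF x) a)
    _ ≤ mean F ^ a * mean (cubeAvg N m K) ^ (s / 2) := hold
    _ ≤ mean F ^ a * (48 * mean K ^ s) := by
        gcongr
        exact mean_cubeAvg_rpow_le hm hsymm hcard hcommon hV hK0 hs0 (by linarith)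
    _ ≤ mean F ^ a * (48 * (mean E ^ c * (48 * mean G ^ b) * (48 * mean H ^ d))) := by gcongr
    _ = _ := by ring

end Neighbours

/-! ### Geometry of circles in the plane. -/

section Circle

variable {F : Type*} [Field F]

theorem mem_circle {t : F} {x : Fin 2 → F} : x ∈ circle t ↔ x 0 ^ 2 + x 1 ^ 2 = t := Iff.rfl

theorem neg_mem_circle {t : F} {x : Fin 2 → F} : -x ∈ circle t ↔ x ∈ circle t := by
  simp [mem_circle]

theorem sub_mem_circle_comm {t : F} (x y : Fin 2 → F) : x - y ∈ circle t ↔ y - x ∈ circle t := by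
  rw [← neg_mem_circle, neg_sub]

/-- Two circles of radius `t` with distinct centres `y` and `z` that meet in `u` can only meet again
in `y + z - u`. -/
theorem eq_or_eq_of_mem_circle (h2 : (2 : F) ≠ 0) {t : F} (ht : t ≠ 0) {y z u v : Fin 2 → F}
    (hyz : y ≠ z) (hu : y - u ∈ circle t) (hu' : z - u ∈ circle t) (hv : y - v ∈ circle t)
    (hv' : z - v ∈ circle t) : v = u ∨ v = y + z - u := by
  simp only [mem_circle, Pi.sub_apply] at hu hu' hv hv'
  by_cases huv : v = u
  · exact Or.inl huv
  right
  set d0 := z 0 - y 0 with hd0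
  set d1 := z 1 - y 1 with hd1
  set e0 := v 0 - u 0 with he0
  set e1 := v 1 - u 1 with he1
  set s0 := v 0 + u 0 - y 0 - z 0 with hs0
  set s1 := v 1 + u 1 - y 1 - z 1 with hs1
  have hd : d0 ≠ 0 ∨ d1 ≠ 0 := by
    by_contra! h
    exact hyz (funext fun i => by
      fin_cases i
      · exact (sub_eq_zero.1 h.1).symm
      · exact (sub_eq_zero.1 h.2).symm)
  have he : e0 ≠ 0 ∨ e1 ≠ 0 := by
    by_contra! h
    exact huv (funext fun i => by
      fin_cases i
      · exact sub_eq_zero.1 h.1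
      · exact sub_eq_zero.1 h.2)
  -- `e` is orthogonal to `d` and to `s`, and `s` is orthogonal to `d`
  have hed : e0 * d0 + e1 * d1 = 0 := by
    have : 2 * (e0 * d0 + e1 * d1) = 0 := by
      simp only [hd0, hd1, he0, he1]; linear_combination hu' - hu + hv - hv'
    exact (mul_eq_zero.1 this).resolve_left h2
  have hes : e0 * s0 + e1 * s1 = 0 := by
    have : 2 * (e0 * s0 + e1 * s1) = 0 := by
      simp only [hs0, hs1, he0, he1]; linear_combination hv + hv' - hu - hu'
    exact (mul_eq_zero.1 this).resolve_left h2
  have hsd : s0 * d0 + s1 * d1 = 0 := by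
    simp only [hs0, hs1, hd0, hd1]
    have : (2 : F) * ((v 0 + u 0 - y 0 - z 0) * (z 0 - y 0)
        + (v 1 + u 1 - y 1 - z 1) * (z 1 - y 1)) = 0 := by
      linear_combination hu - hu' + hv - hv'
    exact (mul_eq_zero.1 this).resolve_left h2
  -- Both `s` and `d` are orthogonal to the nonzero vector `e` of the plane, so they are parallel.
  -- As `s` is also orthogonal to `d`, it vanishes once `d` is known to be non-isotropic, and `s =
  -- 0` is the claim.
  have hdet : s0 * d1 - s1 * d0 = 0 := by
    rcases he with h | h
    · refine (mul_eq_zero.1 (?_ : e0 * (s0 * d1 - s1 * d0) = 0)).resolve_left h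
      linear_combination d1 * hes - s1 * hed
    · refine (mul_eq_zero.1 (?_ : e1 * (s0 * d1 - s1 * d0) = 0)).resolve_left h
      linear_combination s0 * hed - d0 * hes
  have hD : d0 ^ 2 + d1 ^ 2 ≠ 0 := by
    intro hD
    -- an isotropic `d` is orthogonal to the radius `y - u`, which is then isotropic
    have h1 : (y 0 - u 0) * d0 + (y 1 - u 1) * d1 = 0 := by
      have : 2 * ((y 0 - u 0) * d0 + (y 1 - u 1) * d1) = 0 := by
        simp only [hd0, hd1] at hD ⊢
        linear_combination hu' - hu - hD
      exact (mul_eq_zero.1 this).resolve_left h2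
    rcases hd with h | h
    · refine ht ((mul_eq_zero.1 (?_ : d0 ^ 2 * t = 0)).resolve_left (pow_ne_zero 2 h))
      rw [← hu]
      linear_combination ((y 0 - u 0) * d0 - (y 1 - u 1) * d1) * h1 + (y 1 - u 1) ^ 2 * hD
    · refine ht ((mul_eq_zero.1 (?_ : d1 ^ 2 * t = 0)).resolve_left (pow_ne_zero 2 h))
      rw [← hu]
      linear_combination ((y 1 - u 1) * d1 - (y 0 - u 0) * d0) * h1 + (y 0 - u 0) ^ 2 * hD
  have h0 : s0 = 0 := (mul_eq_zero.1 (by linear_combination d0 * hsd + d1 * hdet :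
    (d0 ^ 2 + d1 ^ 2) * s0 = 0)).resolve_left hD
  have h1 : s1 = 0 := (mul_eq_zero.1 (by linear_combination d1 * hsd - d0 * hdet :
    (d0 ^ 2 + d1 ^ 2) * s1 = 0)).resolve_left hD
  funext i
  fin_cases i
  · change v 0 = y 0 + z 0 - u 0
    linear_combination h0
  · change v 1 = y 1 + z 1 - u 1
    linear_combination h1

/-- The rotation by sixty degrees, where `r` is a square root of three. -/
def rotate (r : F) (x : Fin 2 → F) : Fin 2 → F :=
  ![(x 0 - r * x 1) / 2, (x 1 + r * x 0) / 2]

theorem rotate_mem_circle (h2 : (2 : F) ≠ 0) {r : F} (hr : 3 = r * r) {t : F} {x : Fin 2 → F}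
    (hx : x ∈ circle t) : rotate r x ∈ circle t := by
  rw [mem_circle] at hx ⊢
  simp only [rotate, Matrix.cons_val_zero, Matrix.cons_val_one]
  rw [div_pow, div_pow, ← add_div, div_eq_iff (pow_ne_zero 2 h2)]
  linear_combination 4 * hx - (x 0 ^ 2 + x 1 ^ 2) * hr

theorem sub_rotate_mem_circle (h2 : (2 : F) ≠ 0) {r : F} (hr : 3 = r * r) {t : F} {x : Fin 2 → F}
    (hx : x ∈ circle t) : x - rotate r x ∈ circle t := by
  rw [mem_circle] at hx ⊢
  simp only [rotate, Pi.sub_apply, Matrix.cons_val_zero, Matrix.cons_val_one]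
  have e0 : x 0 - (x 0 - r * x 1) / 2 = (x 0 + r * x 1) / 2 := by field_simp; ring
  have e1 : x 1 - (x 1 + r * x 0) / 2 = (x 1 - r * x 0) / 2 := by field_simp; ring
  rw [e0, e1, div_pow, div_pow, ← add_div, div_eq_iff (pow_ne_zero 2 h2)]
  linear_combination 4 * hx - (x 0 ^ 2 + x 1 ^ 2) * hr

end Circle

/-! ### Counting points on circles and their intersections. -/

section Count

variable {F : Type*} [Field F] [Fintype F]

/-- In odd characteristic an element `a` has `quadraticChar F a + 1` square roots. -/
theorem sum_comp_sq [DecidableEq F] (hF : ringChar F ≠ 2) (f : F → ℤ) :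
    ∑ u, f (u ^ 2) = ∑ a, (quadraticChar F a + 1) * f a := by
  rw [← Finset.sum_fiberwise (Finset.univ : Finset F) (fun u => u ^ 2)]
  refine Finset.sum_congr rfl fun a _ => ?_
  rw [← quadraticChar_card_sqrts hF a, Finset.sum_congr rfl (g := fun _ => f a)
    (by intro u hu; rw [(Finset.mem_filter.1 hu).2]), Finset.sum_const, nsmul_eq_mul]
  congr 2
  congr 1
  ext u; simp

/-- Replacing both squares by the quadratic character `χ` gives `∑ a, (χ a + 1) * (χ (t - a) + 1)`.
The linear terms sum to zero, and the substitution `a = t * c` turns the product term into the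
Jacobi sum of `χ` and its inverse, equal to `-χ (-1)`. -/
theorem ncard_circle [DecidableEq F] (h2 : (2 : F) ≠ 0) {t : F} (ht : t ≠ 0) :
    ((circle t).ncard : ℤ) = Fintype.card F - quadraticChar F (-1) := by
  have hF : ringChar F ≠ 2 := fun h => h2 (by
    have := ringChar.Nat.cast_ringChar (R := F)
    rw [h] at this
    exact_mod_cast this)
  have hcard : ((circle t).ncard : ℤ) = ∑ u : F, ∑ v : F, if u ^ 2 + v ^ 2 = t then 1 else 0 := by
    have : circle t = ↑(Finset.univ.filter fun x : Fin 2 → F => x 0 ^ 2 + x 1 ^ 2 = t) := by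
      ext x; simp [mem_circle]
    rw [this, Set.ncard_coe_finset, Finset.card_filter, Nat.cast_sum,
      ← Fintype.sum_prod_type' (f := fun u v : F => if u ^ 2 + v ^ 2 = t then (1 : ℤ) else 0)]
    refine Fintype.sum_equiv (finTwoArrowEquiv F) _ _ fun x => ?_
    simp
  rw [hcard, sum_comp_sq hF (fun a => ∑ v : F, if a + v ^ 2 = t then (1 : ℤ) else 0)]
  have hin : ∀ a : F, (∑ v : F, if a + v ^ 2 = t then (1 : ℤ) else 0)
      = quadraticChar F (t - a) + 1 := by
    intro a
    rw [sum_comp_sq hF (fun b => if a + b = t then (1 : ℤ) else 0)]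
    simp [← eq_sub_iff_add_eq']
  have hshift : ∑ a : F, quadraticChar F (t - a) = 0 := by
    rw [← quadraticChar_sum_zero hF]
    exact Fintype.sum_equiv (Equiv.subLeft t) _ _ fun a => rfl
  have hconv : ∑ a : F, quadraticChar F a * quadraticChar F (t - a) = -quadraticChar F (-1) := by
    rw [← jacobiSum_nontrivial_inv (quadraticChar_ne_one hF), jacobiSum,
      (quadraticChar_isQuadratic F).inv]
    symm
    refine Fintype.sum_equiv (Equiv.mulLeft₀ t ht) _ _ fun c => ?_
    have : t - t * c = t * (1 - c) := by ring
    simp only [Equiv.mulLeft₀_apply, this, map_mul]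
    linear_combination (-(quadraticChar F c * quadraticChar F (1 - c))) * quadraticChar_sq_one ht
  calc ∑ a, (quadraticChar F a + 1) * _
      = ∑ a, (quadraticChar F a * quadraticChar F (t - a) + quadraticChar F a
          + quadraticChar F (t - a) + 1) :=
        Finset.sum_congr rfl fun a _ => by rw [hin]; ring
    _ = _ := by
      simp only [Finset.sum_add_distrib, hconv, hshift, quadraticChar_sum_zero hF]
      simp
      ring

theorem ncard_circle_bounds (h2 : (2 : F) ≠ 0) {t : F} (ht : t ≠ 0) :
    Fintype.card F ≤ 2 * (circle t).ncard ∧ (circle t).ncard ≤ 2 * Fintype.card F := by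
  classical
  have h := ncard_circle h2 ht
  have h1 : (1 : ℕ) < Fintype.card F := Fintype.one_lt_card
  rcases quadraticChar_dichotomy (neg_ne_zero.2 (one_ne_zero (α := F))) with hc | hc <;>
    rw [hc] at h <;> omega

open Classical in
/-- The neighbours of `x` in the graph of pairs at distance `t`. -/
def circleNbrs (t : F) (x : Fin 2 → F) : Finset (Fin 2 → F) :=
  Finset.univ.filter fun y => x - y ∈ circle t

theorem mem_circleNbrs {t : F} {x y : Fin 2 → F} : y ∈ circleNbrs t x ↔ x - y ∈ circle t := by
  simp [circleNbrs]

theorem circleNbrs_symm (t : F) (x y : Fin 2 → F) :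
    y ∈ circleNbrs t x ↔ x ∈ circleNbrs t y := by
  rw [mem_circleNbrs, mem_circleNbrs, sub_mem_circle_comm]

theorem card_circleNbrs (t : F) (x : Fin 2 → F) : (circleNbrs t x).card = (circle t).ncard := by
  rw [← Set.ncard_coe_finset]
  refine Set.ncard_congr (fun y _ => x - y) (fun y hy => mem_circleNbrs.1 hy)
    (fun y z _ _ h => sub_right_injective h)
    (fun z hz => ⟨x - z, mem_circleNbrs.2 (by simpa using hz), by simp⟩)

theorem card_circleNbrs_inter_le [DecidableEq (Fin 2 → F)] (h2 : (2 : F) ≠ 0) {t : F} (ht : t ≠ 0)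
    (y z : Fin 2 → F) (hyz : y ≠ z) : (circleNbrs t y ∩ circleNbrs t z).card ≤ 2 := by
  rcases (circleNbrs t y ∩ circleNbrs t z).eq_empty_or_nonempty with h | ⟨u, hu⟩
  · simp [h]
  · refine (Finset.card_le_card (t := {u, y + z - u}) fun v hv => ?_).trans Finset.card_le_two
    simp only [Finset.mem_inter, mem_circleNbrs] at hu hv
    simpa using eq_or_eq_of_mem_circle h2 ht hyz hu.1 hu.2 hv.1 hv.2

end Count

/-! ### The two forms and norms of indicators. -/

theorem sum_fin_four {V : Type*} [Fintype V] (G : (Fin 4 → V) → ℝ) :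
    ∑ x, G x = ∑ a, ∑ b, ∑ c, ∑ d, G ![a, b, c, d] := by
  have key : ∀ (n : ℕ) (G : (Fin (n + 1) → V) → ℝ),
      ∑ x, G x = ∑ a, ∑ x : Fin n → V, G (Fin.cons a x) := by
    intro n G
    rw [← Fintype.sum_prod_type']
    exact (Fintype.sum_equiv (Fin.consEquiv fun _ => V) _ _ fun x => rfl).symm
  simp only [key, Fintype.sum_unique]
  refine Finset.sum_congr rfl fun a _ => Finset.sum_congr rfl fun b _ =>
    Finset.sum_congr rfl fun c _ => Finset.sum_congr rfl fun d _ => ?_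
  congr 1

section Forms

variable {F : Type*} [Field F]

theorem circleInd_nonneg (t : F) (x : Fin 2 → F) : 0 ≤ circleInd t x :=
  Set.indicator_nonneg (fun _ _ => zero_le_one) x

theorem circleInd_of_mem {t : F} {x : Fin 2 → F} (hx : x ∈ circle t) : circleInd t x = 1 :=
  Set.indicator_of_mem hx _

variable [Fintype F]

theorem sum_circleInd_mul (t : F) (f : (Fin 2 → F) → ℝ) (x : Fin 2 → F) :
    ∑ y, circleInd t (x - y) * f y = ∑ y ∈ circleNbrs t x, f y := by
  classical
  simp [circleNbrs, Finset.sum_filter, circleInd, Set.indicator_apply]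

theorem yForm_eq (t : F) (f : Fin 4 → (Fin 2 → F) → ℝ) :
    yForm t f = mean fun x => f 2 x * nbrAvg (circleNbrs t) (circle t).ncard (f 0) x *
      nbrAvg (circleNbrs t) (circle t).ncard (f 1) x *
      nbrAvg (circleNbrs t) (circle t).ncard (f 3) x := by
  have hsum : ∑ x : Fin 4 → (Fin 2 → F), circleInd t (x 2 - x 0) * circleInd t (x 2 - x 1) *
      circleInd t (x 2 - x 3) * ∏ l, f l (x l) = ∑ c, f 2 c * (∑ y ∈ circleNbrs t c, f 0 y) *
      (∑ y ∈ circleNbrs t c, f 1 y) * ∑ y ∈ circleNbrs t c, f 3 y := by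
    have hprod : ∀ (k : ℝ) (A B D : (Fin 2 → F) → ℝ), k * (∑ a, A a) * (∑ b, B b) * ∑ d, D d
        = ∑ a, ∑ b, ∑ d, k * A a * B b * D d := by
      intro k A B D
      rw [Finset.mul_sum (f := A), Finset.sum_mul_sum, Finset.sum_mul]
      refine Finset.sum_congr rfl fun a _ => ?_
      rw [Finset.sum_mul]
      exact Finset.sum_congr rfl fun b _ => Finset.mul_sum _ _ _
    rw [sum_fin_four]
    simp only [← sum_circleInd_mul, Fin.prod_univ_four, hprod]
    rw [Finset.sum_congr rfl fun a _ => Finset.sum_comm, Finset.sum_comm]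
    refine Finset.sum_congr rfl fun c _ => Finset.sum_congr rfl fun a _ =>
      Finset.sum_congr rfl fun b _ => Finset.sum_congr rfl fun d _ => ?_
    simp
    ring
  rw [yForm, hsum]
  simp only [mean, nbrAvg, Finset.mul_sum]
  refine Finset.sum_congr rfl fun c _ => ?_
  simp only [← Finset.mul_sum, Fintype.card_pi, Finset.prod_const, Finset.card_univ,
    Fintype.card_fin, Nat.cast_pow, one_div, mul_inv]
  ring

/-- The configurations `φ u` with `u` on the circle are distinct and contribute 1 each; their number
cancels the factor `|S_t|` of the normalization. -/
theorem le_diamondForm {t : F} (hpos : 0 < (circle t).ncard) {f : Fin 4 → (Fin 2 → F) → ℝ}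
    (hf : ∀ l x, 0 ≤ f l x) (φ : (Fin 2 → F) → Fin 4 → (Fin 2 → F)) (hφ : Function.Injective φ)
    (hedge : ∀ u ∈ circle t, φ u 0 - φ u 1 ∈ circle t ∧ φ u 1 - φ u 2 ∈ circle t ∧
      φ u 2 - φ u 3 ∈ circle t ∧ φ u 3 - φ u 0 ∈ circle t ∧ φ u 0 - φ u 2 ∈ circle t)
    (hone : ∀ u ∈ circle t, ∀ l, f l (φ u l) = 1) :
    ((Fintype.card F : ℝ) ^ 2)⁻¹ ≤ diamondForm t f := by
  classical
  have hm : (0 : ℝ) < (circle t).ncard := by exact_mod_cast hpos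
  have hsum : ((circle t).ncard : ℝ) ≤ ∑ x : Fin 4 → (Fin 2 → F),
      circleInd t (x 0 - x 1) * circleInd t (x 1 - x 2) * circleInd t (x 2 - x 3) *
        circleInd t (x 3 - x 0) * circleInd t (x 0 - x 2) * ∏ l, f l (x l) := by
    have hs : (circle t).ncard = (circle t).toFinset.card := Set.ncard_eq_toFinset_card' _
    refine le_trans (le_of_eq ?_) (Finset.sum_le_univ_sum_of_nonneg
      (s := (circle t).toFinset.image φ) fun x => ?_)
    · rw [Finset.sum_image hφ.injOn, Finset.sum_congr rfl (g := fun _ => (1 : ℝ)), hs]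
      · simp
      · intro u hu
        rw [Set.mem_toFinset] at hu
        obtain ⟨h1, h2, h3, h4, h5⟩ := hedge u hu
        simp [circleInd_of_mem, h1, h2, h3, h4, h5, hone u hu]
    · have := circleInd_nonneg t
      exact mul_nonneg (mul_nonneg (mul_nonneg (mul_nonneg (mul_nonneg (this _) (this _)) (this _))
        (this _)) (this _)) (Finset.prod_nonneg fun l _ => hf l _)
  have hq : (0 : ℝ) < Fintype.card F := by exact_mod_cast Fintype.card_pos
  calc ((Fintype.card F : ℝ) ^ 2)⁻¹
      = 1 / ((Fintype.card F : ℝ) ^ 2 * (circle t).ncard) * (circle t).ncard := by field_simp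
    _ ≤ _ := mul_le_mul_of_nonneg_left hsum (by positivity)

theorem normLp_indicator_le {α : Type*} [Fintype α] (p : ℝ≥0∞) (hp : 1 ≤ p) (E : Set α) :
    normLp p (E.indicator fun _ => 1) ≤ (E.ncard / Fintype.card α : ℝ) ^ p.toReal⁻¹ := by
  classical
  rw [normLp]
  split_ifs with h
  -- Since `∞.toReal = 0` and `0⁻¹ = 0`, the right-hand side is a zeroth power, equal to 1 even for
  -- empty `E`.
  · simp only [h, ENNReal.toReal_top, inv_zero, Real.rpow_zero]
    refine Real.iSup_le (fun x => ?_) zero_le_one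
    by_cases hx : x ∈ E <;> simp [hx]
  · have hp0 : p.toReal ≠ 0 := (ENNReal.toReal_pos (by positivity) h).ne'
    have hsum : ∑ x, |E.indicator (fun _ => (1 : ℝ)) x| ^ p.toReal = E.ncard := by
      have : ∀ x, |E.indicator (fun _ => (1 : ℝ)) x| ^ p.toReal = if x ∈ E then 1 else 0 := by
        intro x
        by_cases hx : x ∈ E <;> simp [hx, hp0]
      simp [this, Set.ncard_eq_toFinset_card', Set.toFinset]
    rw [hsum, one_div, div_eq_inv_mul]

end Forms

theorem ncard_rpow_le {q m : ℕ} (hq : 0 < q) (hmq : m ≤ 2 * q) {a : ℝ} (ha0 : 0 ≤ a) (ha1 : a ≤ 1) :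
    ((m : ℝ) / (q : ℝ) ^ 2) ^ a ≤ 2 * (q : ℝ) ^ (-a) := by
  have hq' : (0 : ℝ) < q := by exact_mod_cast hq
  have hmq' : (m : ℝ) ≤ 2 * q := by exact_mod_cast hmq
  calc ((m : ℝ) / (q : ℝ) ^ 2) ^ a ≤ (2 * (q : ℝ)⁻¹) ^ a := by
        refine Real.rpow_le_rpow (by positivity) ?_ ha0
        rw [div_le_iff₀ (by positivity)]
        refine hmq'.trans_eq ?_
        field_simp
    _ = 2 ^ a * (q : ℝ) ^ (-a) := by
        rw [Real.mul_rpow zero_le_two (by positivity), Real.inv_rpow hq'.le, Real.rpow_neg hq'.le]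
    _ ≤ 2 ^ (1 : ℝ) * (q : ℝ) ^ (-a) := by gcongr; norm_num
    _ = _ := by rw [Real.rpow_one]

theorem inv_toReal_le_one {p : ℝ≥0∞} (hp : 1 ≤ p) : p.toReal⁻¹ ≤ 1 := by
  by_cases h : p = ∞
  · simp [h]
  · exact inv_le_one_of_one_le₀ (by simpa using ENNReal.toReal_mono h hp)

theorem normLp_nonneg {α : Type*} [Fintype α] (p : ℝ≥0∞) (f : α → ℝ) : 0 ≤ normLp p f := by
  rw [normLp]
  split_ifs
  · exact Real.iSup_nonneg fun x => abs_nonneg _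
  · positivity

/-! ### Necessary exponents, sufficient exponents and bounded fields. -/

section Forms

variable {F : Type*} [Field F] [Fintype F]

/-- Testing the diamond form on indicators of points and circles. -/
theorem rpow_card_le_of_diamondForm_le (h2 : (2 : F) ≠ 0) {t : F} (ht : t ≠ 0)
    {p : Fin 4 → ℝ≥0∞} (hp : ∀ l, 1 ≤ p l) {C : ℝ} (hC : 0 < C)
    (hbound : ∀ f : Fin 4 → (Fin 2 → F) → ℝ, (∀ l x, 0 ≤ f l x) →
      diamondForm t f ≤ C * ∏ l, normLp (p l) (f l))
    (e : Fin 4 → ℝ) (E : Fin 4 → Set (Fin 2 → F))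
    (hE : ∀ l, e l = 2 ∧ E l = {0} ∨ e l = 1 ∧ E l = circle t)
    (φ : (Fin 2 → F) → Fin 4 → (Fin 2 → F)) (hφ : Function.Injective φ)
    (hedge : ∀ u ∈ circle t, φ u 0 - φ u 1 ∈ circle t ∧ φ u 1 - φ u 2 ∈ circle t ∧
      φ u 2 - φ u 3 ∈ circle t ∧ φ u 3 - φ u 0 ∈ circle t ∧ φ u 0 - φ u 2 ∈ circle t)
    (hmem : ∀ u ∈ circle t, ∀ l, φ u l ∈ E l) :
    (Fintype.card F : ℝ) ^ (∑ l, e l * (p l).toReal⁻¹ - 2) ≤ 16 * C := by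
  obtain ⟨hm1, hm2⟩ := ncard_circle_bounds h2 ht
  have hqn : 0 < Fintype.card F := Fintype.card_pos
  have hq : (0 : ℝ) < Fintype.card F := by exact_mod_cast hqn
  have ha1 : ∀ l, (p l).toReal⁻¹ ≤ 1 := fun l => inv_toReal_le_one (hp l)
  have hcard : (Fintype.card (Fin 2 → F) : ℝ) = (Fintype.card F : ℝ) ^ 2 := by simp
  -- `e l` is the codimension of `E l`: a point has density `q ^ (-2)`, a circle at most `2 * q ^
  -- (-1)`. The four factors 2 produce the constant 16.
  have hnorm : ∀ l, normLp (p l) ((E l).indicator fun _ => 1)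
      ≤ 2 * (Fintype.card F : ℝ) ^ (-(e l * (p l).toReal⁻¹)) := by
    intro l
    refine (normLp_indicator_le (p l) (hp l) (E l)).trans ?_
    rw [hcard]
    rcases hE l with ⟨h, h'⟩ | ⟨h, h'⟩ <;> rw [h, h']
    · rw [Set.ncard_singleton, Nat.cast_one, one_div, Real.inv_rpow (by positivity),
        ← Real.rpow_natCast, ← Real.rpow_mul hq.le, ← Real.rpow_neg hq.le]
      have := Real.rpow_nonneg hq.le (-(2 * (p l).toReal⁻¹))
      push_cast
      linarith
    · rw [one_mul]
      exact ncard_rpow_le hqn hm2 (by positivity) (ha1 l)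
  have hnonneg : ∀ l x, 0 ≤ (E l).indicator (fun _ => (1 : ℝ)) x := fun l x =>
    Set.indicator_nonneg (fun _ _ => zero_le_one) x
  have h1 := (le_diamondForm (by omega) hnonneg φ hφ hedge
    fun u hu l => Set.indicator_of_mem (hmem u hu l) _).trans (hbound _ hnonneg)
  have h3 : ∏ l, normLp (p l) ((E l).indicator fun _ => 1)
      ≤ 16 * (Fintype.card F : ℝ) ^ (-∑ l, e l * (p l).toReal⁻¹) := by
    refine (Finset.prod_le_prod (fun l _ => normLp_nonneg _ _) fun l _ => hnorm l).trans_eq ?_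
    rw [Finset.prod_mul_distrib, ← Finset.sum_neg_distrib, Real.rpow_sum_of_pos hq]
    norm_num
  have h4 : ((Fintype.card F : ℝ) ^ 2)⁻¹
      ≤ 16 * C * (Fintype.card F : ℝ) ^ (-∑ l, e l * (p l).toReal⁻¹) :=
    h1.trans ((mul_le_mul_of_nonneg_left h3 hC.le).trans_eq (by ring))
  rw [Real.rpow_neg hq.le, ← div_eq_mul_inv, le_div_iff₀ (by positivity)] at h4
  rw [Real.rpow_sub hq, div_eq_inv_mul]
  exact_mod_cast h4

/-- Each non-negative function is dominated by a power of a function with controlled mean. -/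
theorem exists_le_mul_rpow {α : Type*} [Fintype α] [Nonempty α] {p : ℝ≥0∞} (hp : 1 ≤ p)
    {f : α → ℝ} (hf : ∀ x, 0 ≤ f x) :
    ∃ (κ : ℝ) (G : α → ℝ), 0 ≤ κ ∧ (∀ x, 0 ≤ G x) ∧ (∀ x, f x ≤ κ * G x ^ p.toReal⁻¹) ∧
      κ * mean G ^ p.toReal⁻¹ = normLp p f := by
  by_cases h : p = ∞
  -- For `p = ∞` the exponent `p.toReal⁻¹` is zero, so `κ` carries the whole norm.
  · refine ⟨⨆ x, |f x|, fun _ => 1, Real.iSup_nonneg fun x => abs_nonneg _,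
      fun _ => zero_le_one, fun x => ?_, by simp [normLp, h]⟩
    simp only [h, ENNReal.toReal_top, inv_zero, Real.rpow_zero, mul_one]
    exact (le_abs_self _).trans (le_ciSup (f := fun x => |f x|) (Set.finite_range _).bddAbove x)
  · have hp0 : p.toReal ≠ 0 := (ENNReal.toReal_pos (by positivity) h).ne'
    refine ⟨1, fun x => f x ^ p.toReal, zero_le_one, fun x => Real.rpow_nonneg (hf x) _,
      fun x => ?_, ?_⟩
    · rw [one_mul, Real.rpow_rpow_inv (hf x) hp0]
    · simp [normLp, h, mean, abs_of_nonneg (hf _)]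

/-- Passing from `f l` to `κ l * G l ^ (1 / p l)` turns the norm inequality into one between means,
homogeneous in the `κ l`, and treats finite and infinite exponents alike. -/
theorem yForm_le_of_mean_le {t : F} {p : Fin 4 → ℝ≥0∞} (hp : ∀ l, 1 ≤ p l) {K : ℝ}
    (hK : ∀ G : Fin 4 → (Fin 2 → F) → ℝ, (∀ l x, 0 ≤ G l x) →
      mean (fun x => G 2 x ^ (p 2).toReal⁻¹ *
        nbrAvg (circleNbrs t) (circle t).ncard (fun y => G 0 y ^ (p 0).toReal⁻¹) x *
        nbrAvg (circleNbrs t) (circle t).ncard (fun y => G 1 y ^ (p 1).toReal⁻¹) x *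
        nbrAvg (circleNbrs t) (circle t).ncard (fun y => G 3 y ^ (p 3).toReal⁻¹) x) ≤
        K * ∏ l, mean (G l) ^ (p l).toReal⁻¹)
    {f : Fin 4 → (Fin 2 → F) → ℝ} (hf : ∀ l x, 0 ≤ f l x) :
    yForm t f ≤ K * ∏ l, normLp (p l) (f l) := by
  choose κ G hκ hG hle hnorm using fun l => exists_le_mul_rpow (hp l) (hf l)
  have hnbr : ∀ l x, nbrAvg (circleNbrs t) (circle t).ncard (f l) x ≤ κ l *
      nbrAvg (circleNbrs t) (circle t).ncard (fun y => G l y ^ (p l).toReal⁻¹) x := by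
    intro l x
    refine (nbrAvg_mono (hle l) x).trans_eq ?_
    simp only [nbrAvg, ← Finset.mul_sum]
    ring
  have hpow : ∀ l x, 0 ≤ κ l * G l x ^ (p l).toReal⁻¹ := fun l x => (hf l x).trans (hle l x)
  have hnn := fun l x => nbrAvg_nonneg (N := circleNbrs t) (m := (circle t).ncard) (hf l) x
  have hnn' := fun l x => (hnn l x).trans (hnbr l x)
  rw [yForm_eq]
  calc _ ≤ _ := mean_mono fun x => mul_le_mul (mul_le_mul (mul_le_mul (hle 2 x) (hnbr 0 x)
          (hnn 0 x) (hpow 2 x)) (hnbr 1 x) (hnn 1 x) (mul_nonneg (hpow 2 x) (hnn' 0 x)))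
          (hnbr 3 x) (hnn 3 x) (mul_nonneg (mul_nonneg (hpow 2 x) (hnn' 0 x)) (hnn' 1 x))
    _ = (∏ l, κ l) * _ := by
        rw [← mean_const_mul]
        congr 1
        ext x
        rw [Fin.prod_univ_four]
        exact (by intros; ring : ∀ k0 k1 k2 k3 g0 g1 g2 g3 : ℝ,
          k2 * g2 * (k0 * g0) * (k1 * g1) * (k3 * g3)
            = k0 * k1 * k2 * k3 * (g2 * g0 * g1 * g3)) _ _ _ _ _ _ _ _
    _ ≤ (∏ l, κ l) * _ :=
        mul_le_mul_of_nonneg_left (hK G hG) (Finset.prod_nonneg fun l _ => hκ l)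
    _ = K * ∏ l, normLp (p l) (f l) := by
        simp only [← hnorm, Finset.prod_mul_distrib]
        ring

/-- The `Y` form is bounded under the necessary conditions for the boundedness of the diamond
form. -/
theorem yForm_le_of_exponents (h2 : (2 : F) ≠ 0) {t : F} (ht : t ≠ 0) {p : Fin 4 → ℝ≥0∞}
    (hp : ∀ l, 1 ≤ p l)
    (h₁ : (p 0).toReal⁻¹ + (p 1).toReal⁻¹ + 2 * (p 2).toReal⁻¹ + (p 3).toReal⁻¹ ≤ 2)
    (h₂ : (p 0).toReal⁻¹ + 2 * (p 1).toReal⁻¹ + (p 2).toReal⁻¹ + 2 * (p 3).toReal⁻¹ ≤ 2)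
    (h₃ : 2 * (p 0).toReal⁻¹ + (p 1).toReal⁻¹ + (p 2).toReal⁻¹ + (p 3).toReal⁻¹ ≤ 2)
    {f : Fin 4 → (Fin 2 → F) → ℝ} (hf : ∀ l x, 0 ≤ f l x) :
    yForm t f ≤ 48 ^ 3 * ∏ l, normLp (p l) (f l) := by
  classical
  refine yForm_le_of_mean_le hp (fun G hG => ?_) hf
  obtain ⟨hm1, -⟩ := ncard_circle_bounds h2 ht
  have hm : 0 < (circle t).ncard := by
    have : 0 < Fintype.card F := Fintype.card_pos
    omega
  have hV : (Fintype.card (Fin 2 → F) : ℝ) ≤ 4 * ((circle t).ncard : ℝ) ^ 2 := by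
    have : (Fintype.card F : ℝ) ≤ 2 * (circle t).ncard := by exact_mod_cast hm1
    have h := pow_le_pow_left₀ (by positivity) this 2
    simp only [Fintype.card_pi, Finset.prod_const, Finset.card_univ, Fintype.card_fin,
      Nat.cast_pow]
    linarith
  have ha : ∀ l, 0 ≤ (p l).toReal⁻¹ := fun l => by positivity
  have small := @mean_star_le_of_small _ _ _ _ _ _ hm (circleNbrs_symm t) (card_circleNbrs t)
    (card_circleNbrs_inter_le h2 ht) hV
  have large := @mean_star_le_of_large _ _ _ _ _ _ hm (circleNbrs_symm t) (card_circleNbrs t)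
    (card_circleNbrs_inter_le h2 ht) hV
  have a0 := ha 0
  have a1 := ha 1
  have a2 := ha 2
  have a3 := ha 3
  rw [Fin.prod_univ_four]
  -- `h₁` is the Hölder condition when all leaves are small, `h₃` serves a large leaf 0, and `h₂` a
  -- large leaf 1 or 3. A large leaf 1 or 3 leaves at most `2 / 3` for `a0 + a2` plus twice the
  -- exponent of the opposite leaf, so the other leaves are then small.
  rcases le_total (p 1).toReal⁻¹ (2 / 3) with b1 | b1
  · rcases le_total (p 3).toReal⁻¹ (2 / 3) with b3 | b3
    · rcases le_total (p 0).toReal⁻¹ (2 / 3) with b0 | b0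
      · exact (small (hG 2) (hG 0) (hG 1) (hG 3) a2 a0 a1 a3 b0 b1 b3 (by linarith)).trans_eq
          (by ring)
      · exact (large (hG 2) (hG 0) (hG 1) (hG 3) a2 a1 a3 b0 b1 b3 (by linarith)).trans_eq
          (by ring)
    · refine Eq.trans_le ?_ ((large (hG 2) (hG 3) (hG 0) (hG 1) a2 a0 a1 b3 (by linarith) b1
        (by linarith)).trans_eq (by ring))
      congr 1; ext x; ring
  · refine Eq.trans_le ?_ ((large (hG 2) (hG 1) (hG 0) (hG 3) a2 a0 a3 b1 (by linarith)
      (by linarith) (by linarith)).trans_eq (by ring))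
    congr 1; ext x; ring

/-- The `Y` form is bounded by a power of the size of the field. -/
theorem yForm_le_card (h2 : (2 : F) ≠ 0) {t : F} (ht : t ≠ 0) {p : Fin 4 → ℝ≥0∞}
    (hp : ∀ l, 1 ≤ p l) {f : Fin 4 → (Fin 2 → F) → ℝ} (hf : ∀ l x, 0 ≤ f l x) :
    yForm t f ≤ (Fintype.card F : ℝ) ^ 8 * ∏ l, normLp (p l) (f l) := by
  refine yForm_le_of_mean_le hp (fun G hG => ?_) hf
  obtain ⟨hm1, -⟩ := ncard_circle_bounds h2 ht
  have hm : 0 < (circle t).ncard := by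
    have : 0 < Fintype.card F := Fintype.card_pos
    omega
  have ha : ∀ l, 0 ≤ (p l).toReal⁻¹ := fun l => by positivity
  have ha1 : ∀ l, (p l).toReal⁻¹ ≤ 1 := fun l => inv_toReal_le_one (hp l)
  refine (mean_star_le_card hm (card_circleNbrs t) (hG 2) (hG 0) (hG 1) (hG 3) (ha 2) (ha 0)
    (ha 1) (ha 3) (ha1 2) (ha1 0) (ha1 1) (ha1 3)).trans_eq ?_
  simp only [Fin.prod_univ_four, Fintype.card_pi, Finset.prod_const, Finset.card_univ,
    Fintype.card_fin, Nat.cast_pow]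
  ring

/-- A bound on a positive power of `q` bounds `q` itself, so the polynomial loss of `yForm_le_card`
becomes a constant. -/
theorem uniformlyBounded_yForm_of_rpow_card_le {ι : Type*} {F : ι → Type*} [∀ i, Field (F i)]
    [∀ i, Fintype (F i)] (h2 : ∀ i, (2 : F i) ≠ 0) {t : ∀ i, F i} (ht : ∀ i, t i ≠ 0)
    {p : Fin 4 → ℝ≥0∞} (hp : ∀ l, 1 ≤ p l) {δ B : ℝ} (hδ : 0 < δ)
    (hB : ∀ i, (Fintype.card (F i) : ℝ) ^ δ ≤ B) :
    UniformlyBounded F (fun i => yForm (t i)) p := by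
  refine ⟨max 1 (B ^ δ⁻¹) ^ 8, by positivity, fun i f hf =>
    (yForm_le_card (h2 i) (ht i) hp hf).trans ?_⟩
  have hq : (0 : ℝ) ≤ Fintype.card (F i) := Nat.cast_nonneg _
  have h : (Fintype.card (F i) : ℝ) ≤ B ^ δ⁻¹ := by
    have := Real.rpow_le_rpow (Real.rpow_nonneg hq δ) (hB i) (inv_nonneg.2 hδ.le)
    rwa [Real.rpow_rpow_inv hq hδ.ne'] at this
  refine mul_le_mul_of_nonneg_right (pow_le_pow_left₀ hq (h.trans (le_max_right _ _)) 8)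
    (Finset.prod_nonneg fun l _ => ?_)
  exact normLp_nonneg _ _

end Forms

end FiniteFieldForms

end

/-! ### Deduction of the theorem from three test configurations. -/

open FiniteFieldForms in
theorem theorem10p5 {ι : Type*} (F : ι → Type*) [∀ i, Field (F i)] [∀ i, Fintype (F i)]
    (hodd : ∀ i, (2 : F i) ≠ 0) (hthree : ∀ i, IsSquare (3 : F i))
    (t : ∀ i, F i) (ht : ∀ i, t i ≠ 0)
    (p : Fin 4 → ENNReal) (hp : ∀ l, 1 ≤ p l)
    (hdiamond : FiniteFieldForms.UniformlyBounded F
      (fun i => FiniteFieldForms.diamondForm (t i)) p) :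
    FiniteFieldForms.UniformlyBounded F (fun i => FiniteFieldForms.yForm (t i)) p := by
  obtain ⟨C, hC, hbound⟩ := hdiamond
  choose r hr using hthree
  have hneg : ∀ (i : ι) {x : Fin 2 → F i}, x ∈ circle (t i) → -x ∈ circle (t i) :=
    fun i _ hx => neg_mem_circle.2 hx
  by_cases h₁ : (p 0).toReal⁻¹ + (p 1).toReal⁻¹ + 2 * (p 2).toReal⁻¹ + (p 3).toReal⁻¹ ≤ 2
  swap
  · refine uniformlyBounded_yForm_of_rpow_card_le hodd ht hp (sub_pos.2 (not_le.1 h₁))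
      (B := 16 * C) fun i => ?_
    -- Vertex 2 sits at the origin. Vertices 1 and 3 may coincide, as no edge joins them.
    have := rpow_card_le_of_diamondForm_le (hodd i) (ht i) hp hC (hbound i) ![1, 1, 2, 1]
      ![circle (t i), circle (t i), {0}, circle (t i)]
      (by intro l; fin_cases l <;> simp)
      (fun u => ![u, rotate (r i) u, 0, rotate (r i) u]) (fun u v h => congrFun h 0)
      (fun u hu => by
        have h1 := rotate_mem_circle (hodd i) (hr i) hu
        have h2 := sub_rotate_mem_circle (hodd i) (hr i) hu
        have h3 := (sub_mem_circle_comm _ _).1 h2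
        have h4 := hneg i h1
        simp_all)
      (fun u hu l => by
        have h1 := rotate_mem_circle (hodd i) (hr i) hu
        fin_cases l <;> simp_all)
    simpa [Fin.sum_univ_four] using this
  by_cases h₂ : (p 0).toReal⁻¹ + 2 * (p 1).toReal⁻¹ + (p 2).toReal⁻¹ + 2 * (p 3).toReal⁻¹ ≤ 2
  swap
  · refine uniformlyBounded_yForm_of_rpow_card_le hodd ht hp (sub_pos.2 (not_le.1 h₂))
      (B := 16 * C) fun i => ?_
    -- Vertices 1 and 3 both sit at the origin, and the diagonal is the opposite side of the
    -- triangle.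
    have := rpow_card_le_of_diamondForm_le (hodd i) (ht i) hp hC (hbound i) ![1, 2, 1, 2]
      ![circle (t i), {0}, circle (t i), {0}]
      (by intro l; fin_cases l <;> simp)
      (fun u => ![u, 0, rotate (r i) u, 0]) (fun u v h => congrFun h 0)
      (fun u hu => by
        have h1 := rotate_mem_circle (hodd i) (hr i) hu
        have h2 := sub_rotate_mem_circle (hodd i) (hr i) hu
        have h3 := hneg i hu
        have h4 := hneg i h1
        simp_all)
      (fun u hu l => by
        have h1 := rotate_mem_circle (hodd i) (hr i) hu
        fin_cases l <;> simp_all)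
    simpa [Fin.sum_univ_four] using this
  by_cases h₃ : 2 * (p 0).toReal⁻¹ + (p 1).toReal⁻¹ + (p 2).toReal⁻¹ + (p 3).toReal⁻¹ ≤ 2
  swap
  · refine uniformlyBounded_yForm_of_rpow_card_le hodd ht hp (sub_pos.2 (not_le.1 h₃))
      (B := 16 * C) fun i => ?_
    -- The first test with the ends 0 and 2 of the diagonal exchanged.
    have := rpow_card_le_of_diamondForm_le (hodd i) (ht i) hp hC (hbound i) ![2, 1, 1, 1]
      ![{0}, circle (t i), circle (t i), circle (t i)]
      (by intro l; fin_cases l <;> simp)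
      (fun u => ![0, rotate (r i) u, u, rotate (r i) u]) (fun u v h => congrFun h 2)
      (fun u hu => by
        have h1 := rotate_mem_circle (hodd i) (hr i) hu
        have h2 := sub_rotate_mem_circle (hodd i) (hr i) hu
        have h3 := (sub_mem_circle_comm _ _).1 h2
        have h4 := hneg i h1
        have h5 := hneg i hu
        simp_all)
      (fun u hu l => by
        have h1 := rotate_mem_circle (hodd i) (hr i) hu
        fin_cases l <;> simp_all)
    simpa [Fin.sum_univ_four] using this
  exact ⟨48 ^ 3, by norm_num, fun i f hf =>
    yForm_le_of_exponents (hodd i) (ht i) hp h₁ h₂ h₃ hf⟩
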